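/- Let $G \subseteq \mathbb{C}$ be a simply connected domain and let $\lambda(z)\,|dz|$ be a regular conformal metric on $G$, i.e. $\lambda : G \to (0,\infty)$ is of class $C^2$. Suppose that $\lambda(z)\,|dz|$ has constant Gauss curvature $-1$, i.e. $$\kappa_\lambda(z) := -\frac{\Delta(\log\lambda)(z)}{\lambda(z)^2} = -1 \qquad (z \in G), \qquad \Delta = \frac{\partial^2}{\partial x^2}+\frac{\partial^2}{\partial y^2}.$$ Let $\mathbb{D} = \{z \in \mathbb{C} : |z|<1\}$. Then there exists a locally univalent (that is, locally injective) analytic function $f : G \to \mathbb{D}$ such that $$\lambda(z) = \frac{2\,|f'(z)|}{1-|f(z)|^2} \qquad (z \in G).$$ Moreover, whenever $f : G \to \mathbb{D}$ is such a function and $g : G \to \mathbb{D}$ is any locally univalent analytic function, then $$\lambda(z) = \frac{2\,|g'(z)|}{1-|g(z)|^2} \qquad (z \in G)$$ if and only if $g = T\circ f$ for some conformal self-map $T$ of $\mathbb{D}$ (that is, a holomorphic bijection $T : \mathbb{D} \to \mathbb{D}$). -/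

import Mathlib

open Set Metric

/-- `lam` is (the density of) a conformal pseudo-metric `lam(z) |dz|` on `G`: it is continuous,
nonnegative and not identically zero on `G`. -/
def IsConformalDensityOn (lam : ℂ → ℝ) (G : Set ℂ) : Prop :=
  ContinuousOn lam G ∧ (∀ z ∈ G, 0 ≤ lam z) ∧ ∃ z ∈ G, lam z ≠ 0

/-- `lam(z) |dz|` is a conformal metric on `G`: a conformal pseudo-metric with positive density. -/
def IsConformalMetricOn (lam : ℂ → ℝ) (G : Set ℂ) : Prop :=
  IsConformalDensityOn lam G ∧ ∀ z ∈ G, 0 < lam z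

/-- `lam(z) |dz|` is a regular conformal metric on `G`: a conformal metric on `G` whose density is
of class `C²` (in the real sense) in `{z ∈ G | lam z > 0}`. -/
def IsRegularConformalMetricOn (lam : ℂ → ℝ) (G : Set ℂ) : Prop :=
  IsConformalMetricOn lam G ∧ ContDiffOn ℝ 2 lam {z ∈ G | 0 < lam z}

/-- The Gauss curvature `-Δ(log lam)(z) / lam(z)²`, where `Δ = ∂²/∂x² + ∂²/∂y²`. -/
noncomputable def gaussCurvature (lam : ℂ → ℝ) (z : ℂ) : ℝ :=
  -(Laplacian.laplacian (fun w : ℂ => Real.log (lam w)) z) / lam z ^ 2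

/-- `f` restricts to a locally univalent analytic function from `G` to the open unit disk:
it is analytic on `G`, maps `G` into the disk, and is injective near every point of `G`. -/
def IsLocallyUnivalentToDisk (f : ℂ → ℂ) (G : Set ℂ) : Prop :=
  AnalyticOnNhd ℂ f G ∧ MapsTo f G (ball (0 : ℂ) 1) ∧
    ∀ z ∈ G, ∃ U : Set ℂ, IsOpen U ∧ z ∈ U ∧ U ⊆ G ∧ InjOn f U

/-- `T` restricts to a conformal self-map (holomorphic bijection) of the open unit disk. -/
def IsConformalSelfMapOfDisk (T : ℂ → ℂ) : Prop :=
  AnalyticOnNhd ℂ T (ball (0 : ℂ) 1) ∧ BijOn T (ball (0 : ℂ) 1) (ball (0 : ℂ) 1)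

/-!
A metric `exp u |dz|` has curvature `-1` exactly when `u` solves Liouville's equation
`Δ u = exp (2 u)`, and this equation is the vanishing of the curvature of the real-linear system
`dX = (exp u / 2 * conj X - u_z * X) dz` for a function `X` with values in `ℂ`, a real plane
(`metricConnection_flat`). The connection form only involves first derivatives of `u`, so it is
continuously differentiable and no regularity beyond `C²` is needed.

A flat linear system has a local fundamental solution (`exists_local_parallel_frame`): solve the
ordinary differential equation along the rays from a point, and compare neighbouring rays by
Grönwall's inequality. The local solutions glue to a flat bundle whose fibre carries the discrete
topology, that is, to a covering of the domain; over a simply connected domain it has a section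
(`exists_parallel_frame`).

Solutions `X` of the system are holomorphic, because `dX` is a multiple of `dz`, and for two of them
`exp u * Im (conj X * Z)` is constant. If it is positive, `f = (X + i Z) / (X - i Z)` maps into the
disk, and computing `f'` from the system gives `exp u = 2 |f'| / (1 - |f|²)`
(`exists_developing_map`).

For uniqueness, automorphisms of the disk and a rotation reduce to two maps with the same value `0`
and the same derivative at one point; comparing leading terms shows that such maps have equal germs
there (`eventuallyEq_of_pullback_eq`), and the identity theorem applies. Conversely a conformal
self-map of the disk preserves the hyperbolic metric by the Schwarz–Pick lemma for it and its
inverse (`IsConformalSelfMapOfDisk.norm_deriv_mul`).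
-/

open scoped Topology ComplexConjugate

/-! ### Local solutions of flat linear systems -/

/-- A continuously differentiable map is approximated by its derivative uniformly on a compact
convex set. -/
theorem exists_forall_norm_sub_sub_le_of_continuousOn_fderiv {V F : Type*}
    [NormedAddCommGroup V] [NormedSpace ℝ V] [NormedAddCommGroup F] [NormedSpace ℝ F]
    {f : V → F} {f' : V → V →L[ℝ] F} {K : Set V} (hK : IsCompact K) (hconv : Convex ℝ K)
    (hf : ∀ z ∈ K, HasFDerivAt f (f' z) z) (hf' : ContinuousOn f' K) {ε : ℝ} (hε : 0 < ε) :
    ∃ δ > 0, ∀ z ∈ K, ∀ w ∈ K, ‖w - z‖ < δ → ‖f w - f z - f' z (w - z)‖ ≤ ε * ‖w - z‖ := by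
  obtain ⟨δ, hδ, h⟩ := Metric.uniformContinuousOn_iff.1
    (hK.uniformContinuousOn_of_continuous hf') ε hε
  refine ⟨δ, hδ, fun z hz w hw hzw => ?_⟩
  have hs : Convex ℝ (K ∩ ball z δ) := hconv.inter (convex_ball z δ)
  refine hs.norm_image_sub_le_of_norm_hasFDerivWithin_le' (f' := f')
    (fun x hx => (hf x hx.1).hasFDerivWithinAt) (fun x hx => ?_) ⟨hz, mem_ball_self hδ⟩
    ⟨hw, by rwa [mem_ball, dist_eq_norm]⟩
  rw [← dist_eq_norm]
  exact (h x hx.1 z hz hx.2).le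

section Local

variable {V A : Type*} [NormedAddCommGroup V] [NormedSpace ℝ V] [NormedRing A] [NormedAlgebra ℝ A]

/-- Picard–Lindelöf for a linear equation `Y' = a Y` on `[0, 1]` with a small coefficient. -/
theorem exists_linear_ode_solution [CompleteSpace A] {a : ℝ → A}
    (ha : ContinuousOn a (Icc 0 1)) {c : ℝ} (hac : ∀ t ∈ Icc (0 : ℝ) 1, ‖a t‖ ≤ c)
    (hc : c * (‖(1 : A)‖ + 1) ≤ 1) :
    ∃ Y : ℝ → A, Y 0 = 1 ∧ ∀ t ∈ Icc (0 : ℝ) 1, HasDerivWithinAt Y (a t * Y t) (Icc 0 1) t := by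
  have hc0 : 0 ≤ c := (norm_nonneg _).trans (hac 0 (by simp))
  have hpl : IsPicardLindelof (fun t Y => a t * Y) (tmin := 0) (tmax := 1) ⟨0, by simp⟩
      (1 : A) 1 0 1 ⟨c, hc0⟩ := by
    refine ⟨fun t ht => ?_, fun x _ => ha.mul continuousOn_const, fun t ht x hx => ?_, by simp⟩
    · refine LipschitzWith.lipschitzOnWith (LipschitzWith.of_dist_le_mul fun x y => ?_)
      rw [dist_eq_norm, dist_eq_norm, ← mul_sub]
      exact (norm_mul_le _ _).trans (mul_le_mul_of_nonneg_right (hac t ht) (norm_nonneg _))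
    · have hx1 : ‖x‖ ≤ ‖(1 : A)‖ + 1 := by
        have := norm_le_norm_add_norm_sub' x 1
        rw [mem_closedBall, dist_eq_norm] at hx
        simp only [NNReal.coe_one] at hx
        linarith
      refine ((norm_mul_le _ _).trans ?_).trans hc
      exact mul_le_mul (hac t ht) hx1 (norm_nonneg _) hc0
  exact hpl.exists_eq_forall_mem_Icc_hasDerivWithinAt₀

/-- **Frobenius theorem for linear systems, local form.** Let `ω` be a continuously differentiable
connection form with values in a Banach algebra and with vanishing curvature. Then
`dΦ = ω Φ` has an invertible solution near every point: at `x₀ + v` it is the value at time `1` of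
the solution along the segment from `x₀`. -/
theorem exists_local_parallel_frame [ProperSpace V] [CompleteSpace A] {G : Set V} (hG : IsOpen G)
    {ω : V → V →L[ℝ] A} {ω' : V → V →L[ℝ] V →L[ℝ] A}
    (hω : ∀ z ∈ G, HasFDerivAt ω (ω' z) z) (hω' : ContinuousOn ω' G)
    (hflat : ∀ z ∈ G, ∀ h k, ω' z h k + ω z k * ω z h = ω' z k h + ω z h * ω z k)
    {x₀ : V} (hx₀ : x₀ ∈ G) :
    ∃ r > 0, ball x₀ r ⊆ G ∧ ∃ Φ : V → A, ∀ z ∈ ball x₀ r, IsUnit (Φ z) ∧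
      HasFDerivAt Φ ((ContinuousLinearMap.mul ℝ A).flip (Φ z) ∘L ω z) z := by
  obtain ⟨R, hR, hRG⟩ := Metric.nhds_basis_closedBall.mem_iff.1 (hG.mem_nhds hx₀)
  have hK := isCompact_closedBall x₀ R
  have hωc : ContinuousOn ω G := fun z hz => (hω z hz).continuousAt.continuousWithinAt
  obtain ⟨C₁, hC₁⟩ := hK.exists_bound_of_continuousOn (f := ω) (hωc.mono hRG)
  obtain ⟨C₂, hC₂⟩ := hK.exists_bound_of_continuousOn (f := ω') (hω'.mono hRG)
  obtain ⟨C, hC0, hC1, hC2⟩ : ∃ C : ℝ, 0 < C ∧ (∀ z ∈ closedBall x₀ R, ‖ω z‖ ≤ C) ∧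
      ∀ z ∈ closedBall x₀ R, ‖ω' z‖ ≤ C :=
    ⟨max (max C₁ C₂) 1, by positivity, fun z hz => (hC₁ z hz).trans (by simp),
      fun z hz => (hC₂ z hz).trans (by simp)⟩
  obtain ⟨r, hr, hrR, hrC⟩ : ∃ r > 0, r ≤ R ∧ C * r * (‖(1 : A)‖ + 1) ≤ 1 := by
    have hp : 0 < C * (‖(1 : A)‖ + 1) := by positivity
    refine ⟨min R (1 / (C * (‖(1 : A)‖ + 1))), by positivity, min_le_left _ _, ?_⟩
    have := min_le_right R (1 / (C * (‖(1 : A)‖ + 1)))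
    rw [le_div_iff₀ hp] at this
    linarith
  have hseg : ∀ v ∈ ball (0 : V) r, ∀ t ∈ Icc (0 : ℝ) 1, x₀ + t • v ∈ closedBall x₀ R := by
    intro v hv t ht
    rw [mem_ball_zero_iff] at hv
    rw [mem_closedBall, dist_eq_norm, add_sub_cancel_left, norm_smul, Real.norm_of_nonneg ht.1]
    have := mul_le_mul_of_nonneg_right ht.2 (norm_nonneg v)
    linarith
  have hline : ∀ (v : V) (t : ℝ), HasDerivAt (fun s : ℝ => x₀ + s • v) v t := fun v t => by
    simpa using ((hasDerivAt_id t).smul_const v).const_add x₀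
  -- solve along the rays from `x₀`
  have hsol : ∀ v ∈ ball (0 : V) r, ∃ Y : ℝ → A, Y 0 = 1 ∧ ∀ t ∈ Icc (0 : ℝ) 1,
      HasDerivWithinAt Y (ω (x₀ + t • v) v * Y t) (Icc 0 1) t := by
    intro v hv
    refine exists_linear_ode_solution (c := C * r) ?_ (fun t ht => ?_) hrC
    · refine ContinuousOn.clm_apply (hωc.comp (by fun_prop) fun t ht => hRG (hseg v hv t ht))
        continuousOn_const
    · refine (ContinuousLinearMap.le_opNorm _ _).trans ?_
      exact mul_le_mul (hC1 _ (hseg v hv t ht)) (mem_ball_zero_iff.1 hv).le (norm_nonneg _) hC0.le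
  choose! Y hY0 hY using hsol
  have key : ∀ z ∈ ball x₀ r, HasFDerivAt (fun w => Y (w - x₀) 1)
      ((ContinuousLinearMap.mul ℝ A).flip (Y (z - x₀) 1) ∘L ω z) z := by
    intro z hz
    set v := z - x₀ with hv_def
    have hv : v ∈ ball (0 : V) r := by
      rwa [mem_ball_zero_iff, hv_def, ← dist_eq_norm]
    have hYc : ContinuousOn (Y v) (Icc 0 1) := fun t ht => (hY v hv t ht).continuousWithinAt
    obtain ⟨M₀, hM₀⟩ := isCompact_Icc.exists_bound_of_continuousOn hYc
    obtain ⟨M, hM0, hM⟩ : ∃ M : ℝ, 0 < M ∧ ∀ t ∈ Icc (0 : ℝ) 1, ‖Y v t‖ ≤ M :=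
      ⟨max M₀ 1, by positivity, fun t ht => (hM₀ t ht).trans (by simp)⟩
    rw [hasFDerivAt_iff_isLittleO_nhds_zero, Asymptotics.isLittleO_iff]
    intro c hc
    -- the constant `B` collects the factors by which Grönwall amplifies the defect
    set B : ℝ := (C + r + C * (C * r + C)) * M / (C * r) * (Real.exp (C * r * (1 - 0)) - 1) with hB
    have hB0 : 0 ≤ B := by
      have : 0 ≤ Real.exp (C * r * (1 - 0)) - 1 := by
        have := Real.add_one_le_exp (C * r * (1 - 0))
        have : 0 < C * r := by positivity
        linarith
      positivity
    set ε := c / (B + 1) with hε_def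
    have hε : 0 < ε := by positivity
    obtain ⟨δ, hδ, hunif⟩ := exists_forall_norm_sub_sub_le_of_continuousOn_fderiv hK
      (convex_closedBall x₀ R) (fun z hz => hω z (hRG hz)) (hω'.mono hRG) hε
    have hev1 : ∀ᶠ k : V in 𝓝 0, v + k ∈ ball (0 : V) r := by
      have : Filter.Tendsto (fun k : V => v + k) (𝓝 0) (𝓝 (v + 0)) := by
        exact (continuous_const.add continuous_id).tendsto 0
      rw [add_zero] at this
      exact this (isOpen_ball.mem_nhds hv)
    filter_upwards [hev1, ball_mem_nhds (0 : V) hδ, ball_mem_nhds (0 : V) hε] with k hvk hkδ hkε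
    rw [mem_ball_zero_iff] at hkδ hkε
    have hzk : z + k - x₀ = v + k := by rw [hv_def]; abel
    rw [hzk]
    -- `e` is the difference of the solutions on two neighbouring rays minus the variation that the
    -- equation predicts; flatness makes it an approximate solution with defect `o(k)`
    set e : ℝ → A := fun t => Y (v + k) t - Y v t - t • (ω (x₀ + t • v) k * Y v t) with he_def
    set e' : ℝ → A := fun t => ω (x₀ + t • (v + k)) (v + k) * Y (v + k) t - ω (x₀ + t • v) v * Y v t
      - (t • (ω' (x₀ + t • v) v k * Y v t + ω (x₀ + t • v) k * (ω (x₀ + t • v) v * Y v t))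
        + (1 : ℝ) • (ω (x₀ + t • v) k * Y v t)) with he'_def
    have he : ∀ t ∈ Icc (0 : ℝ) 1, HasDerivWithinAt e (e' t) (Icc 0 1) t := by
      intro t ht
      have h1 : HasDerivWithinAt (fun s : ℝ => ω (x₀ + s • v) k) (ω' (x₀ + t • v) v k)
          (Icc 0 1) t := by
        have h2 := (hω _ (hRG (hseg v hv t ht))).comp_hasDerivAt t (hline v t)
        have h3 := ((ContinuousLinearMap.apply ℝ A k).hasFDerivAt).comp_hasDerivAt t h2
        exact h3.hasDerivWithinAt
      exact ((hY _ hvk t ht).sub (hY v hv t ht)).sub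
        ((hasDerivWithinAt_id t _).smul (h1.mul (hY v hv t ht)))
    have hbound : ∀ t ∈ Ico (0 : ℝ) 1, ‖e' t‖ ≤ C * r * ‖e t‖
        + (C + r + C * (C * r + C)) * M * (ε * ‖k‖) := by
      intro t ht'
      have ht : t ∈ Icc (0 : ℝ) 1 := Ico_subset_Icc_self ht'
      have hz1 := hseg v hv t ht
      have hz2 := hseg _ hvk t ht
      have hsub : x₀ + t • (v + k) - (x₀ + t • v) = t • k := by rw [smul_add]; abel
      have htk : ‖t • k‖ ≤ ‖k‖ := by
        rw [norm_smul, Real.norm_of_nonneg ht.1]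
        exact mul_le_of_le_one_left (norm_nonneg _) ht.2
      have hρ := hunif _ hz1 _ hz2 (by rw [hsub]; exact htk.trans_lt hkδ)
      have hlip : ‖ω (x₀ + t • (v + k)) - ω (x₀ + t • v)‖ ≤ C * ‖k‖ := by
        refine ((convex_closedBall x₀ R).norm_image_sub_le_of_norm_hasFDerivWithin_le
          (fun x hx => (hω x (hRG hx)).hasFDerivWithinAt) hC2 hz1 hz2).trans ?_
        rw [hsub]
        exact mul_le_mul_of_nonneg_left htk hC0.le
      rw [hsub] at hρ
      have hfl := hflat _ (hRG hz1) k v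
      set w := ω (x₀ + t • v) with hw
      set w₂ := ω (x₀ + t • (v + k)) with hw₂
      set d := ω' (x₀ + t • v) with hd
      set ρ := w₂ - w - d (t • k) with hρ_def
      have hw₂' : w₂ = w + t • d k + ρ := by rw [hρ_def, map_smul]; abel
      have hsplit : e' t = w₂ (v + k) * e t + (t • d k k + ρ (v + k)
          + t • (((w₂ - w) v + w₂ k) * w k)) * Y v t := by
        have hdkv : d k v = d v k + w k * w v - w v * w k := by rw [← hfl]; abel
        simp only [he'_def, he_def]
        rw [← hw, ← hw₂, ← hd]
        have hρv : ρ v = w₂ v - w v - t • d k v := by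
          rw [hρ_def]; simp
        have hρk : ρ k = w₂ k - w k - t • d k k := by
          rw [hρ_def]; simp
        rw [map_add ρ, hρv, hρk, hdkv]
        simp only [map_add, _root_.sub_apply, one_smul, add_mul, sub_mul, mul_sub,
          smul_add, smul_sub, smul_mul_assoc, mul_smul_comm, mul_assoc]
        abel
      rw [hsplit]
      have hvk' : ‖v + k‖ ≤ r := (mem_ball_zero_iff.1 hvk).le
      have hv' : ‖v‖ ≤ r := (mem_ball_zero_iff.1 hv).le
      have hw₂n : ‖w₂‖ ≤ C := hC1 _ hz2
      have hwn : ‖w‖ ≤ C := hC1 _ hz1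
      have hdn : ‖d‖ ≤ C := hC2 _ hz1
      have n0 : ‖w₂ (v + k)‖ ≤ C * r := w₂.le_of_opNorm_le_of_le hw₂n hvk'
      have n1 : ‖t • d k k‖ ≤ C * (ε * ‖k‖) := by
        rw [norm_smul, Real.norm_of_nonneg ht.1]
        have h1 : ‖d k‖ ≤ C * ‖k‖ := d.le_of_opNorm_le hdn k
        have h2 : ‖d k k‖ ≤ C * ‖k‖ * ‖k‖ := (d k).le_of_opNorm_le h1 k
        calc t * ‖d k k‖ ≤ 1 * ‖d k k‖ := mul_le_mul_of_nonneg_right ht.2 (norm_nonneg _)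
          _ ≤ C * ‖k‖ * ‖k‖ := by rw [one_mul]; exact h2
          _ = C * (‖k‖ * ‖k‖) := by ring
          _ ≤ C * (ε * ‖k‖) := by gcongr
      have n2 : ‖ρ (v + k)‖ ≤ r * (ε * ‖k‖) := by
        have h1 : ‖ρ‖ ≤ ε * ‖k‖ := hρ.trans (by gcongr)
        calc ‖ρ (v + k)‖ ≤ (ε * ‖k‖) * r := ρ.le_of_opNorm_le_of_le h1 hvk'
          _ = _ := by ring
      have n3 : ‖t • (((w₂ - w) v + w₂ k) * w k)‖ ≤ C * (C * r + C) * (ε * ‖k‖) := by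
        rw [norm_smul, Real.norm_of_nonneg ht.1]
        have h1 : ‖(w₂ - w) v‖ ≤ C * ‖k‖ * r := (w₂ - w).le_of_opNorm_le_of_le hlip hv'
        have h2 : ‖w₂ k‖ ≤ C * ‖k‖ := w₂.le_of_opNorm_le hw₂n k
        have h3 : ‖w k‖ ≤ C * ‖k‖ := w.le_of_opNorm_le hwn k
        calc t * ‖((w₂ - w) v + w₂ k) * w k‖ ≤ 1 * ‖((w₂ - w) v + w₂ k) * w k‖ :=
              mul_le_mul_of_nonneg_right ht.2 (norm_nonneg _)
          _ ≤ (C * ‖k‖ * r + C * ‖k‖) * (C * ‖k‖) := by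
              rw [one_mul]
              refine (norm_mul_le _ _).trans ?_
              gcongr
              exact (norm_add_le _ _).trans (add_le_add h1 h2)
          _ = C * (C * r + C) * (‖k‖ * ‖k‖) := by ring
          _ ≤ C * (C * r + C) * (ε * ‖k‖) := by gcongr
      calc _ ≤ ‖w₂ (v + k) * e t‖ + ‖(t • d k k + ρ (v + k)
          + t • (((w₂ - w) v + w₂ k) * w k)) * Y v t‖ := norm_add_le _ _
        _ ≤ C * r * ‖e t‖ + (C * (ε * ‖k‖) + r * (ε * ‖k‖)
            + C * (C * r + C) * (ε * ‖k‖)) * M := by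
          refine add_le_add ((norm_mul_le _ _).trans (by gcongr)) ((norm_mul_le _ _).trans ?_)
          refine mul_le_mul ?_ (hM t ht) (norm_nonneg _) (by positivity)
          exact (norm_add_le _ _).trans (add_le_add ((norm_add_le _ _).trans (add_le_add n1 n2)) n3)
        _ = _ := by ring
    have hgr := norm_le_gronwallBound_of_norm_deriv_right_le (a := 0) (b := 1) (δ := 0)
      (f := e) (f' := e') (fun t ht => (he t ht).continuousWithinAt)
      (fun t ht => (he t (Ico_subset_Icc_self ht)).mono_of_mem_nhdsWithin
        (Icc_mem_nhdsGE_of_mem ht))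
      (by simp [he_def, hY0 v hv, hY0 _ hvk]) hbound 1 (by simp)
    have hxv : x₀ + v = z := by rw [hv_def]; abel
    have he1 : e 1 = Y (v + k) 1 - Y v 1
        - ((ContinuousLinearMap.mul ℝ A).flip (Y v 1) ∘L ω z) k := by
      simp [he_def, hxv]
    rw [← he1]
    refine hgr.trans ?_
    rw [gronwallBound_of_K_ne_0 (by positivity)]
    calc _ = B * ε * ‖k‖ := by rw [hB]; ring
      _ ≤ c * ‖k‖ := by
        gcongr
        rw [hε_def, mul_div_assoc', div_le_iff₀ (by positivity)]
        nlinarith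
  -- invertibility holds near `x₀`, where the solution equals `1`
  have hY1 : Y 0 1 = 1 := by
    have hv : (0 : V) ∈ ball (0 : V) r := mem_ball_self hr
    have hgr := norm_le_gronwallBound_of_norm_deriv_right_le (a := 0) (b := 1) (δ := 0) (K := 0)
      (ε := 0) (f := fun t => Y 0 t - 1) (f' := fun _ => 0)
      (fun t ht => ((hY 0 hv t ht).continuousWithinAt).sub continuousWithinAt_const)
      (fun t ht => by
        have := (hY 0 hv t (Ico_subset_Icc_self ht)).mono_of_mem_nhdsWithin
          (Icc_mem_nhdsGE_of_mem ht)
        simpa using this.sub_const (1 : A))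
      (by simp [hY0 0 hv]) (by simp) 1 (by simp)
    rw [gronwallBound_K0] at hgr
    simpa [sub_eq_zero] using hgr
  have hunit : ∀ᶠ z in 𝓝 x₀, IsUnit (Y (z - x₀) 1) := by
    have hcont := (key x₀ (mem_ball_self hr)).continuousAt
    refine hcont.eventually_mem (Units.isOpen.mem_nhds ?_)
    simp [hY1]
  obtain ⟨r', hr', hball⟩ := Metric.mem_nhds_iff.1 hunit
  refine ⟨min r r', lt_min hr hr', fun z hz => hRG ?_, fun w => Y (w - x₀) 1, fun z hz =>
    ⟨hball (ball_subset_ball (min_le_right _ _) hz),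
      key z (ball_subset_ball (min_le_left _ _) hz)⟩⟩
  exact ball_subset_closedBall (ball_subset_ball ((min_le_left _ _).trans hrR) hz)

end Local

/-! ### Flat linear systems on simply connected domains -/

section Global

variable {V A : Type*} [NormedAddCommGroup V] [NormedSpace ℝ V] [NormedRing A] [NormedAlgebra ℝ A]

/-- Two solutions of `dΦ = ω Φ` on a convex open set, the first one invertible, differ by a constant
right factor. -/
theorem inverse_mul_eq_of_parallel [CompleteSpace A] {U : Set V} (hU : IsOpen U)
    (hc : Convex ℝ U) {ω : V → V →L[ℝ] A} {Φ Ψ : V → A} (hu : ∀ z ∈ U, IsUnit (Φ z))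
    (hΦ : ∀ z ∈ U, HasFDerivAt Φ ((ContinuousLinearMap.mul ℝ A).flip (Φ z) ∘L ω z) z)
    (hΨ : ∀ z ∈ U, HasFDerivAt Ψ ((ContinuousLinearMap.mul ℝ A).flip (Ψ z) ∘L ω z) z)
    {z w : V} (hz : z ∈ U) (hw : w ∈ U) :
    Ring.inverse (Φ z) * Ψ z = Ring.inverse (Φ w) * Ψ w := by
  have hd : ∀ x ∈ U, HasFDerivAt (fun x => Ring.inverse (Φ x) * Ψ x) (0 : V →L[ℝ] A) x := by
    intro x hx
    obtain ⟨u, hux⟩ := hu x hx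
    have hi : HasFDerivAt (𝕜 := ℝ) (Ring.inverse : A → A)
        (-ContinuousLinearMap.mulLeftRight ℝ A ↑u⁻¹ ↑u⁻¹) (Φ x) := by
      rw [← hux]; exact hasFDerivAt_ringInverse (𝕜 := ℝ) u
    convert! (hi.comp x (hΦ x hx)).mul' (hΨ x hx) using 1
    ext k
    simp [← hux, mul_assoc]
  refine hU.is_const_of_fderiv_eq_zero (𝕜 := ℝ) hc.isPreconnected
    (fun x hx => (hd x hx).differentiableAt.differentiableWithinAt)
    (fun x hx => (hd x hx).fderiv) hz hw

/-- A copy of a type carrying the discrete topology: the fibre of a flat bundle. -/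
structure DiscreteCopy (A : Type*) where
  /-- The underlying element. -/
  val : A

instance (A : Type*) : TopologicalSpace (DiscreteCopy A) := ⊥

instance (A : Type*) : DiscreteTopology (DiscreteCopy A) := ⟨rfl⟩

/-- The flat bundle glued from parallel frames `Φ x` on balls around the points `x` of `G`: in the
chart `x`, the discrete coordinate `a` over `z` stands for the value `Φ x z * a`. Its continuous
sections are the parallel ones. -/
noncomputable def flatBundleCore [CompleteSpace A] {G : Set V} {ω : V → V →L[ℝ] A} (r : G → ℝ)
    (hr : ∀ x, 0 < r x) (Φ : G → V → A)
    (hΦ : ∀ x : G, ∀ z ∈ ball (x : V) (r x), IsUnit (Φ x z) ∧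
      HasFDerivAt (Φ x) ((ContinuousLinearMap.mul ℝ A).flip (Φ x z) ∘L ω z) z) :
    FiberBundleCore G G (DiscreteCopy A) where
  baseSet x := (↑) ⁻¹' ball (x : V) (r x)
  isOpen_baseSet x := isOpen_ball.preimage continuous_subtype_val
  indexAt x := x
  mem_baseSet_at x := mem_ball_self (hr x)
  coordChange x y z a := ⟨Ring.inverse (Φ y z) * Φ x z * a.val⟩
  coordChange_self x z hz a := by
    rw [Ring.inverse_mul_cancel _ (hΦ x z hz).1, one_mul]
  continuousOn_coordChange x y := by
    -- on the convex intersection of two balls the transition function is constant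
    rw [continuousOn_iff_continuous_domRestrict]
    refine IsLocallyConstant.continuous (IsLocallyConstant.iff_exists_open _ |>.2 ?_)
    rintro ⟨⟨z, a⟩, ⟨hzx, hzy⟩, -⟩
    refine ⟨{p | p.1.2 = a}, (isOpen_discrete {a}).preimage
      (continuous_snd.comp continuous_subtype_val), rfl, ?_⟩
    rintro ⟨⟨w, b⟩, ⟨hwx, hwy⟩, -⟩ (rfl : b = a)
    simp only [Set.domRestrict]
    rw [inverse_mul_eq_of_parallel (isOpen_ball.inter isOpen_ball)
      ((convex_ball (x : V) (r x)).inter (convex_ball (y : V) (r y)))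
      (fun z hz => (hΦ y z hz.2).1) (fun z hz => (hΦ y z hz.2).2) (fun z hz => (hΦ x z hz.1).2)
      ⟨hwx, hwy⟩ ⟨hzx, hzy⟩]
  coordChange_comp x y w z hz a := by
    have h := Ring.mul_inverse_cancel _ (hΦ y z hz.1.2).1
    congr 1
    calc _ = Ring.inverse (Φ w z) * (Φ y z * Ring.inverse (Φ y z)) * Φ x z * a.val := by
            simp only [mul_assoc]
      _ = _ := by rw [h, mul_one]

/-- **Frobenius theorem for linear systems, global form.** A connection form with vanishing
curvature has trivial monodromy over a simply connected domain: `dΦ = ω Φ` has a solution there,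
with prescribed value at one point. -/
theorem exists_parallel_frame [ProperSpace V] [CompleteSpace A] {G : Set V}
    (hG : IsOpen G) (hGs : IsSimplyConnected G)
    {ω : V → V →L[ℝ] A} {ω' : V → V →L[ℝ] V →L[ℝ] A}
    (hω : ∀ z ∈ G, HasFDerivAt ω (ω' z) z) (hω' : ContinuousOn ω' G)
    (hflat : ∀ z ∈ G, ∀ h k, ω' z h k + ω z k * ω z h = ω' z k h + ω z h * ω z k)
    {z₀ : V} (hz₀ : z₀ ∈ G) :
    ∃ Φ : V → A, Φ z₀ = 1 ∧
      ∀ z ∈ G, HasFDerivAt Φ ((ContinuousLinearMap.mul ℝ A).flip (Φ z) ∘L ω z) z := by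
  have hloc : ∀ x : G, ∃ r > 0, ball (x : V) r ⊆ G ∧ ∃ Φ : V → A, ∀ z ∈ ball (x : V) r,
      IsUnit (Φ z) ∧ HasFDerivAt Φ ((ContinuousLinearMap.mul ℝ A).flip (Φ z) ∘L ω z) z :=
    fun x => exists_local_parallel_frame hG hω hω' hflat x.2
  choose r hr hrG Φ hΦ using hloc
  let Z := flatBundleCore r hr Φ hΦ
  have hcov : IsCoveringMap (Bundle.TotalSpace.proj : Z.TotalSpace → G) :=
    FiberBundle.isCoveringMap (F := DiscreteCopy A) (E := Z.Fiber)
  have : SimplyConnectedSpace G := hGs.simplyConnectedSpace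
  have : LocallyPathConnectedSpace G := hG.locallyPathConnectedSpace
  obtain ⟨s, ⟨hs0, hs⟩, -⟩ := hcov.existsUnique_continuousMap_lifts (ContinuousMap.id G)
    ⟨z₀, hz₀⟩ ⟨⟨z₀, hz₀⟩, (⟨Ring.inverse (Φ ⟨z₀, hz₀⟩ z₀)⟩ : DiscreteCopy A)⟩ rfl
  have hproj : ∀ z, (s z).1 = z := fun z => congrFun hs z
  let val : Z.TotalSpace → A := fun p => Φ p.1 p.1 * (show DiscreteCopy A from p.2).val
  classical
  let Ψ : V → A := fun w => if h : w ∈ G then val (s ⟨w, h⟩) else 0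
  have hΨ : ∀ (w : V) (h : w ∈ G), Ψ w = val (s ⟨w, h⟩) := fun w h => dif_pos h
  refine ⟨Ψ, ?_, fun z hz => ?_⟩
  · rw [hΨ z₀ hz₀, hs0]
    exact Ring.mul_inverse_cancel _ (hΦ ⟨z₀, hz₀⟩ z₀ (mem_ball_self (hr _))).1
  -- in the chart centred at `z` the section has a locally constant coordinate
  · let x : G := ⟨z, hz⟩
    have hxU : x ∈ Z.baseSet x := Z.mem_baseSet_at x
    have hcoord : ContinuousAt (fun y : G => (Z.localTriv x (s y)).2) x := by
      refine continuous_snd.continuousAt.comp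
        (ContinuousAt.comp ((Z.localTriv x).continuousAt ?_) s.continuous.continuousAt)
      rw [FiberBundleCore.mem_localTriv_source, hproj]
      exact hxU
    have hconst := hcoord.eventually_mem ((isOpen_discrete {(Z.localTriv x (s x)).2}).mem_nhds rfl)
    have hball : ∀ᶠ w in 𝓝 z, w ∈ ball z (r x) := isOpen_ball.mem_nhds (mem_ball_self (hr x))
    have hev : Ψ =ᶠ[𝓝 z] fun w => Φ x w * (Z.localTriv x (s x)).2.val := by
      have h1 : ∀ᶠ w in 𝓝 (x : V), ∀ h : w ∈ G,
          (Z.localTriv x (s ⟨w, h⟩)).2 = (Z.localTriv x (s x)).2 := by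
        rw [← hG.isOpenEmbedding_subtypeVal.map_nhds_eq x, Filter.eventually_map]
        exact hconst.mono fun y hy _ => hy
      filter_upwards [h1, hball] with w hw hwb
      have hwG : w ∈ G := hrG x hwb
      rw [hΨ w hwG, ← hw hwG, FiberBundleCore.localTriv_apply]
      have hp : ((s ⟨w, hwG⟩).1 : V) = w := congrArg Subtype.val (hproj _)
      have hu := (hΦ x w hwb).1
      rw [← hp] at hu
      have hv : val (s ⟨w, hwG⟩) = Φ x (s ⟨w, hwG⟩).1 * (Ring.inverse (Φ x (s ⟨w, hwG⟩).1) *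
          Φ (s ⟨w, hwG⟩).1 (s ⟨w, hwG⟩).1 * (show DiscreteCopy A from (s ⟨w, hwG⟩).2).val) := by
        rw [mul_assoc, ← mul_assoc, Ring.mul_inverse_cancel _ hu, one_mul]
      rw [hv]
      exact congrArg (fun y => Φ x y * _) hp
    refine HasFDerivAt.congr_of_eventuallyEq ?_ hev
    rw [hev.eq_of_nhds]
    convert! ((hΦ x z (mem_ball_self (hr x))).2.mul_const' (Z.localTriv x (s x)).2.val) using 1
    ext k
    simp [mul_assoc]

end Global

/-! ### Liouville's equation as a zero-curvature condition -/

section Connection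

/- Shortcut instances: the instance search fails on iterated spaces of linear maps of this depth. -/
noncomputable instance : NormedAddCommGroup (ℂ →L[ℝ] ℂ →L[ℝ] ℂ) := inferInstance

noncomputable instance : NormedSpace ℝ (ℂ →L[ℝ] ℂ →L[ℝ] ℂ) := inferInstance

noncomputable instance : NormedAddCommGroup (ℂ →L[ℝ] ℂ →L[ℝ] ℂ →L[ℝ] ℂ) := inferInstance

noncomputable instance : NormedSpace ℝ (ℂ →L[ℝ] ℂ →L[ℝ] ℂ →L[ℝ] ℂ) := inferInstance

/-- The real-trilinear map `(a, k, c) ↦ a * k * c`. -/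
noncomputable def mulForm : ℂ →L[ℝ] ℂ →L[ℝ] ℂ →L[ℝ] ℂ :=
  (ContinuousLinearMap.compL ℝ ℂ ℂ (ℂ →L[ℝ] ℂ) (ContinuousLinearMap.mul ℝ ℂ)) ∘L
    (ContinuousLinearMap.mul ℝ ℂ)

@[simp] theorem mulForm_apply (a k c : ℂ) : mulForm a k c = a * k * c := rfl

/-- The real-trilinear map `(b, k, c) ↦ b * k * conj c`. -/
noncomputable def mulConjForm : ℂ →L[ℝ] ℂ →L[ℝ] ℂ →L[ℝ] ℂ :=
  (ContinuousLinearMap.compL ℝ ℂ (ℂ →L[ℝ] ℂ) (ℂ →L[ℝ] ℂ)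
    ((ContinuousLinearMap.compL ℝ ℂ ℂ ℂ).flip (Complex.conjCLE : ℂ →L[ℝ] ℂ))) ∘L mulForm

@[simp] theorem mulConjForm_apply (a k c : ℂ) : mulConjForm a k c = a * k * conj c := rfl

/-- The linear map taking the real differential `D` of a function to its Wirtinger derivative
`∂/∂z`, namely `(D 1 - i D i) / 2`. -/
noncomputable def wirtinger : (ℂ →L[ℝ] ℝ) →L[ℝ] ℂ :=
  (1 / 2 : ℝ) • (Complex.ofRealCLM ∘L ContinuousLinearMap.apply ℝ ℝ (1 : ℂ) -
    Complex.I • (Complex.ofRealCLM ∘L ContinuousLinearMap.apply ℝ ℝ Complex.I))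

@[simp] theorem wirtinger_apply (D : ℂ →L[ℝ] ℝ) :
    wirtinger D = (1 / 2 : ℝ) * (D 1 - Complex.I * D Complex.I) := by
  simp [wirtinger]

/-- The connection form of the metric `exp u |dz|`, with values in the real-linear endomorphisms of
`ℂ`: it is `c ↦ (exp u / 2 * conj c - u_z * c) dz`. -/
noncomputable def metricConnection (u : ℂ → ℝ) (z : ℂ) : ℂ →L[ℝ] ℂ →L[ℝ] ℂ :=
  mulConjForm ((Real.exp (u z) / 2 : ℝ) : ℂ) - mulForm (wirtinger (fderiv ℝ u z))

/-- The differential of `metricConnection u`. -/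
noncomputable def metricConnectionDeriv (u : ℂ → ℝ) (z : ℂ) : ℂ →L[ℝ] ℂ →L[ℝ] ℂ →L[ℝ] ℂ :=
  mulConjForm ∘L (Complex.ofRealCLM ∘L ((Real.exp (u z) / 2) • fderiv ℝ u z)) -
    mulForm ∘L (wirtinger ∘L fderiv ℝ (fderiv ℝ u) z)

theorem metricConnection_apply (u : ℂ → ℝ) (z k c : ℂ) : metricConnection u z k c =
    k * ((Real.exp (u z) / 2 : ℝ) * conj c - wirtinger (fderiv ℝ u z) * c) := by
  simp only [metricConnection, _root_.sub_apply, mulForm_apply, mulConjForm_apply]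
  ring

variable {u : ℂ → ℝ} {G : Set ℂ}

theorem hasFDerivAt_metricConnection (hG : IsOpen G) (hu : ContDiffOn ℝ 2 u G) {z : ℂ}
    (hz : z ∈ G) : HasFDerivAt (metricConnection u) (metricConnectionDeriv u z) z := by
  have h1 : HasFDerivAt u (fderiv ℝ u z) z :=
    ((hu.contDiffAt (hG.mem_nhds hz)).differentiableAt (by norm_num)).hasFDerivAt
  have h2 : HasFDerivAt (fderiv ℝ u) (fderiv ℝ (fderiv ℝ u) z) z :=
    (((hu.fderiv_of_isOpen hG (m := 1) (by norm_num)).contDiffAt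
      (hG.mem_nhds hz)).differentiableAt (by norm_num)).hasFDerivAt
  have h3 : HasFDerivAt (fun w => Real.exp (u w) / 2) ((Real.exp (u z) / 2) • fderiv ℝ u z) z := by
    convert! h1.exp.mul_const (2⁻¹ : ℝ) using 1
    rw [smul_smul]; congr 1; ring
  exact (mulConjForm.hasFDerivAt.comp z (Complex.ofRealCLM.hasFDerivAt.comp z h3)).sub
    (mulForm.hasFDerivAt.comp z (wirtinger.hasFDerivAt.comp z h2))

theorem continuousOn_metricConnectionDeriv (hG : IsOpen G) (hu : ContDiffOn ℝ 2 u G) :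
    ContinuousOn (metricConnectionDeriv u) G := by
  have h1 := hu.fderiv_of_isOpen hG (m := 1) (by norm_num)
  have h2 := (h1.fderiv_of_isOpen hG (m := 0) (by norm_num)).continuousOn
  have h0 := hu.continuousOn
  have h3 := h1.continuousOn
  unfold metricConnectionDeriv
  fun_prop

/-- The Laplace operator in terms of the second differential. -/
theorem laplacian_eq_fderiv_fderiv (u : ℂ → ℝ) (z : ℂ) :
    Laplacian.laplacian u z = fderiv ℝ (fderiv ℝ u) z 1 1 +
      fderiv ℝ (fderiv ℝ u) z Complex.I Complex.I := by
  rw [InnerProductSpace.laplacian_eq_iteratedFDeriv_complexPlane]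
  simp [iteratedFDeriv_two_apply]

/-- Liouville's equation `Δ u = exp (2 u)` says that `metricConnection u` has curvature zero. -/
theorem metricConnection_flat (hG : IsOpen G) (hu : ContDiffOn ℝ 2 u G) {z : ℂ} (hz : z ∈ G)
    (hΔ : Laplacian.laplacian u z = Real.exp (u z) ^ 2) (h k : ℂ) :
    metricConnectionDeriv u z h k + metricConnection u z k * metricConnection u z h =
      metricConnectionDeriv u z k h + metricConnection u z h * metricConnection u z k := by
  have hsymm : IsSymmSndFDerivAt ℝ u z :=
    (hu.contDiffAt (hG.mem_nhds hz)).isSymmSndFDerivAt (by simp)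
  have hIs := hsymm Complex.I 1
  rw [laplacian_eq_fderiv_fderiv] at hΔ
  have hlin : ∀ (F : Type) [NormedAddCommGroup F] [NormedSpace ℝ F] (L : ℂ →L[ℝ] F) (h : ℂ),
      L h = h.re • L 1 + h.im • L Complex.I := fun F _ _ L h => by
    rw [← map_smul, ← map_smul, ← map_add]
    congr 1
    simp [Complex.re_add_im]
  ext c
  simp only [_root_.add_apply, mul_apply_eq_comp, metricConnection_apply,
    metricConnectionDeriv, _root_.sub_apply, ContinuousLinearMap.comp_apply, mulForm_apply,
    mulConjForm_apply, wirtinger_apply, _root_.smul_apply, Complex.ofRealCLM_apply]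
  rw [hlin _ (fderiv ℝ (fderiv ℝ u) z) h, hlin _ (fderiv ℝ (fderiv ℝ u) z) k,
    hlin _ (fderiv ℝ u z) h, hlin _ (fderiv ℝ u z) k]
  simp only [_root_.add_apply, _root_.smul_apply, hIs, smul_eq_mul]
  generalize fderiv ℝ (fderiv ℝ u) z 1 1 = a at *
  generalize fderiv ℝ (fderiv ℝ u) z 1 Complex.I = b at *
  generalize fderiv ℝ (fderiv ℝ u) z Complex.I Complex.I = d at *
  generalize fderiv ℝ u z 1 = p at *
  generalize fderiv ℝ u z Complex.I = q at *
  obtain ⟨e, he⟩ : ∃ e, Real.exp (u z) / 2 = e := ⟨_, rfl⟩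
  rw [show Real.exp (u z) = 2 * e by linarith] at hΔ
  rw [he]
  apply Complex.ext
  · simp
    linear_combination (1 / 2 * (h.re * k.im - h.im * k.re) * c.im) * hΔ
  · simp
    linear_combination (1 / 2 * (h.im * k.re - h.re * k.im) * c.re) * hΔ

end Connection

/-! ### The developing map -/

section Developing

/-- An analytic function with nonzero derivative is injective near the point. -/
theorem exists_isOpen_injOn_of_deriv_ne_zero {f : ℂ → ℂ} {G : Set ℂ} (hG : IsOpen G) {z : ℂ}
    (hz : z ∈ G) (hf : AnalyticAt ℂ f z) (hf' : deriv f z ≠ 0) :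
    ∃ U : Set ℂ, IsOpen U ∧ z ∈ U ∧ U ⊆ G ∧ InjOn f U := by
  have hs : HasStrictFDerivAt f
      ((ContinuousLinearEquiv.unitsEquivAut ℂ (Units.mk0 _ hf') : ℂ ≃L[ℂ] ℂ) : ℂ →L[ℂ] ℂ) z :=
    hf.hasStrictDerivAt.hasStrictFDerivAt_equiv hf'
  let e := hs.toOpenPartialHomeomorph f
  exact ⟨e.source ∩ G, e.open_source.inter hG, ⟨hs.mem_toOpenPartialHomeomorph_source, hz⟩,
    inter_subset_right, e.injOn.mono inter_subset_left⟩

/-- A solution `X` of `dX = (exp u / 2 * conj X - u_z * X) dz` is holomorphic. Two such solutions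
are linearly independent over the reals at every point as soon as they are so at one point, since
`exp u * Im (conj X * Z)` is constant. -/
theorem exists_independent_solutions {u : ℂ → ℝ} {G : Set ℂ} (hG : IsOpen G)
    (hGs : IsSimplyConnected G) (hu : ContDiffOn ℝ 2 u G)
    (hΔ : ∀ z ∈ G, Laplacian.laplacian u z = Real.exp (u z) ^ 2) :
    ∃ X Z : ℂ → ℂ, ∀ z ∈ G, 0 < (conj (X z) * Z z).im ∧
      HasDerivAt X ((Real.exp (u z) / 2 : ℝ) * conj (X z) - wirtinger (fderiv ℝ u z) * X z) z ∧
      HasDerivAt Z ((Real.exp (u z) / 2 : ℝ) * conj (Z z) - wirtinger (fderiv ℝ u z) * Z z) z := by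
  obtain ⟨z₀, hz₀⟩ := hGs.nonempty
  obtain ⟨Φ, hΦ0, hΦ⟩ := exists_parallel_frame hG hGs
    (fun z hz => hasFDerivAt_metricConnection hG hu hz) (continuousOn_metricConnectionDeriv hG hu)
    (fun z hz => metricConnection_flat hG hu hz (hΔ z hz)) hz₀
  have hderiv : ∀ (c : ℂ), ∀ z ∈ G, HasDerivAt (fun z => Φ z c)
      ((Real.exp (u z) / 2 : ℝ) * conj (Φ z c) - wirtinger (fderiv ℝ u z) * Φ z c) z := by
    intro c z hz
    have h1 := (ContinuousLinearMap.apply ℝ ℂ c).hasFDerivAt.comp z (hΦ z hz)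
    rw [hasDerivAt_iff_hasFDerivAt, hasFDerivAt_iff_isLittleO_nhds_zero]
    refine (hasFDerivAt_iff_isLittleO_nhds_zero.1 h1).congr_left fun k => ?_
    simp [metricConnection_apply]
  refine ⟨fun z => Φ z 1, fun z => Φ z Complex.I, fun z hz =>
    ⟨?_, hderiv 1 z hz, hderiv Complex.I z hz⟩⟩
  set X := fun z => Φ z 1 with hX
  set Z := fun z => Φ z Complex.I with hZ
  -- the conserved quantity; at `z₀`, where `X = 1` and `Z = i`, it is `exp (u z₀)`
  let N : ℂ → ℝ := fun z => Real.exp (u z) * (conj (X z) * Z z).im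
  have hN : ∀ z ∈ G, HasFDerivAt N (0 : ℂ →L[ℝ] ℝ) z := by
    intro z hz
    have h1 : HasFDerivAt u (fderiv ℝ u z) z :=
      ((hu.contDiffAt (hG.mem_nhds hz)).differentiableAt (by norm_num)).hasFDerivAt
    have hX1 := (hderiv 1 z hz).hasFDerivAt.restrictScalars ℝ
    have hZ1 := (hderiv Complex.I z hz).hasFDerivAt.restrictScalars ℝ
    have h2 := h1.exp.mul (Complex.imCLM.hasFDerivAt.comp z
      (((Complex.conjCLE : ℂ →L[ℝ] ℂ).hasFDerivAt.comp z hX1).mul hZ1))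
    refine h2.congr_fderiv ?_
    ext k
    have hlin : fderiv ℝ u z k = k.re * fderiv ℝ u z 1 + k.im * fderiv ℝ u z Complex.I := by
      rw [← smul_eq_mul, ← smul_eq_mul, ← map_smul, ← map_smul, ← map_add]
      congr 1
      simp [Complex.re_add_im]
    obtain ⟨e, he⟩ : ∃ e, Real.exp (u z) / 2 = e := ⟨_, rfl⟩
    simp [hlin, he]
    ring
  have hconst := hG.is_const_of_fderiv_eq_zero (𝕜 := ℝ)
    hGs.isPathConnected.isConnected.isPreconnected
    (fun x hx => (hN x hx).differentiableAt.differentiableWithinAt)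
    (fun x hx => (hN x hx).fderiv) hz hz₀
  have h0 : 0 < N z₀ := by
    simp [N, hX, hZ, hΦ0, Real.exp_pos]
  rw [← hconst] at h0
  exact (mul_pos_iff_of_pos_left (Real.exp_pos _)).1 h0

/-- **Liouville's theorem.** A metric `exp u |dz|` of curvature `-1` on a simply connected domain
is the pull-back of the hyperbolic metric of the disk by a holomorphic map. -/
theorem exists_developing_map {u : ℂ → ℝ} {G : Set ℂ} (hG : IsOpen G)
    (hGs : IsSimplyConnected G) (hu : ContDiffOn ℝ 2 u G)
    (hΔ : ∀ z ∈ G, Laplacian.laplacian u z = Real.exp (u z) ^ 2) :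
    ∃ f : ℂ → ℂ, DifferentiableOn ℂ f G ∧ ∀ z ∈ G, ‖f z‖ < 1 ∧
      Real.exp (u z) = 2 * ‖deriv f z‖ / (1 - ‖f z‖ ^ 2) := by
  obtain ⟨X, Z, h⟩ := exists_independent_solutions hG hGs hu hΔ
  -- `Z / X` takes values in the upper half-plane; `a / b` is its image under a Cayley transform
  set a : ℂ → ℂ := fun z => X z + Complex.I * Z z with ha
  set b : ℂ → ℂ := fun z => X z - Complex.I * Z z with hb
  have hab : ∀ z ∈ G, ‖a z‖ ^ 2 < ‖b z‖ ^ 2 := by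
    intro z hz
    have h1 := (h z hz).1
    rw [← Complex.normSq_eq_norm_sq, ← Complex.normSq_eq_norm_sq]
    simp [ha, hb, Complex.normSq_apply] at h1 ⊢
    nlinarith
  have hb0 : ∀ z ∈ G, 0 < ‖b z‖ ^ 2 := fun z hz => (sq_nonneg _).trans_lt (hab z hz)
  have hf : ∀ z ∈ G, HasDerivAt (fun z => a z / b z)
      ((Real.exp (u z) / 2 : ℝ) * ((‖b z‖ ^ 2 - ‖a z‖ ^ 2 : ℝ)) / b z ^ 2) z := by
    intro z hz
    obtain ⟨-, h1, h2⟩ := h z hz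
    have hbz : b z ≠ 0 := fun h0 => by simpa [h0] using hb0 z hz
    convert! (h1.add (h2.const_mul Complex.I)).div (h1.sub (h2.const_mul Complex.I)) hbz using 1
    congr 1
    rw [Complex.ofReal_sub, Complex.ofReal_pow, Complex.ofReal_pow, ← Complex.conj_mul',
      ← Complex.conj_mul']
    simp only [ha, hb, map_add, map_sub, map_mul, Complex.conj_I, Pi.add_apply, Pi.sub_apply]
    ring
  refine ⟨fun z => a z / b z, fun z hz => (hf z hz).differentiableAt.differentiableWithinAt,
    fun z hz => ?_⟩
  have h1 := hab z hz
  have h2 := hb0 z hz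
  have h3 : 0 < ‖b z‖ ^ 2 - ‖a z‖ ^ 2 := by linarith
  have h5 : ‖b z‖ ≠ 0 := fun h0 => by simp [h0] at h2
  have h4 : ‖a z / b z‖ ^ 2 < 1 := by
    rw [norm_div, div_pow, div_lt_one h2]
    exact h1
  refine ⟨by nlinarith [norm_nonneg (a z / b z)], ?_⟩
  rw [(hf z hz).deriv, norm_div, norm_mul, Complex.norm_real, Complex.norm_real,
    Real.norm_of_nonneg h3.le, Real.norm_of_nonneg (by positivity), norm_pow, norm_div, div_pow]
  rw [show 1 - ‖a z‖ ^ 2 / ‖b z‖ ^ 2 = (‖b z‖ ^ 2 - ‖a z‖ ^ 2) / ‖b z‖ ^ 2 by field_simp]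
  field_simp

end Developing

/-! ### Inverses of injective holomorphic functions -/

section Inverse

open Filter

/-- The inverse of an injective holomorphic function is holomorphic. At a critical point this is
Riemann's theorem on removable singularities for the inverse, and there are then no such points. -/
theorem hasDerivAt_invFunOn {f : ℂ → ℂ} {U : Set ℂ} (hU : IsOpen U) (hf : AnalyticOnNhd ℂ f U)
    (hinj : InjOn f U) {a : ℂ} (ha : a ∈ U) :
    deriv f a ≠ 0 ∧ HasDerivAt (Function.invFunOn f U) (deriv f a)⁻¹ (f a) := by
  set S := Function.invFunOn f U with hS
  have hSf : ∀ z ∈ U, S (f z) = z := fun z hz => hinj.leftInvOn_invFunOn hz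
  have hnotconst : ∀ z ∈ U, ¬ ∀ᶠ w in 𝓝 z, f w = f z := by
    intro z hz h
    have h1 : ∀ᶠ w in 𝓝 z, w = z := by
      filter_upwards [h, hU.mem_nhds hz] with w hw hwU using hinj hwU hz hw
    have h2 : ∀ᶠ w in 𝓝[≠] z, w = z := h1.filter_mono nhdsWithin_le_nhds
    obtain ⟨w, hw, hw'⟩ := (h2.and self_mem_nhdsWithin).exists
    exact hw' hw
  have hmap : ∀ z ∈ U, 𝓝 (f z) ≤ map f (𝓝 z) := fun z hz =>
    (hf z hz).eventually_constant_or_nhds_le_map_nhds.resolve_left (hnotconst z hz)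
  have hSc : ∀ z ∈ U, ContinuousAt S (f z) := by
    intro z hz
    have : Tendsto S (map f (𝓝 z)) (𝓝 z) := by
      rw [tendsto_map'_iff]
      refine tendsto_id.congr' ?_
      filter_upwards [hU.mem_nhds hz] with w hw using (hSf w hw).symm
    rw [ContinuousAt, hSf z hz]
    exact this.mono_left (hmap z hz)
  have hSd : ∀ z ∈ U, deriv f z ≠ 0 → HasDerivAt S (deriv f z)⁻¹ (f z) := by
    intro z hz hd
    have hfz : HasDerivAt f (deriv f z) (S (f z)) := by
      rw [hSf z hz]; exact (hf z hz).differentiableAt.hasDerivAt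
    refine HasDerivAt.of_local_left_inverse (hSc z hz) hfz hd ?_
    refine hmap z hz (eventually_map.2 ?_)
    filter_upwards [hU.mem_nhds hz] with w hw
    rw [hSf w hw]
  have hd0 : deriv f a ≠ 0 := by
    have hne : ∀ᶠ z in 𝓝[≠] a, deriv f z ≠ 0 := by
      refine (hf a ha).deriv.eventually_eq_zero_or_eventually_ne_zero.resolve_left fun h => ?_
      obtain ⟨r, hr, hball⟩ := Metric.eventually_nhds_iff_ball.1 (h.and (hU.mem_nhds ha))
      refine hnotconst a ha ?_
      filter_upwards [ball_mem_nhds a hr] with w hw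
      exact isOpen_ball.is_const_of_deriv_eq_zero (convex_ball a r).isPreconnected
        (fun x hx => (hf x (hball x hx).2).differentiableAt.differentiableWithinAt)
        (fun x hx => (hball x hx).1) hw (mem_ball_self hr)
    have hSa : AnalyticAt ℂ S (f a) := by
      refine Complex.analyticAt_of_differentiable_on_punctured_nhds_of_continuousAt ?_ (hSc a ha)
      rw [eventually_nhdsWithin_iff] at hne ⊢
      refine hmap a ha (eventually_map.2 ?_)
      filter_upwards [hne, hU.mem_nhds ha] with z hz hzU hfz
      exact (hSd z hzU (hz fun h => hfz (by rw [mem_singleton_iff.1 h]; rfl))).differentiableAt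
    have hcomp := hSa.differentiableAt.hasDerivAt.comp a (hf a ha).differentiableAt.hasDerivAt
    have hid : S ∘ f =ᶠ[𝓝 a] id := by
      filter_upwards [hU.mem_nhds ha] with w hw using hSf w hw
    have := (hcomp.congr_of_eventuallyEq hid.symm).unique (hasDerivAt_id a)
    intro h0
    simp [h0] at this
  exact ⟨hd0, hSd a ha hd0⟩

end Inverse

/-! ### Automorphisms of the disk -/

section Disk

/-- The automorphism `w ↦ (w - c) / (1 - conj c * w)` of the unit disk taking `c` to `0`. -/
noncomputable def diskAut (c w : ℂ) : ℂ := (w - c) / (1 - conj c * w)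

@[simp] theorem diskAut_self (c : ℂ) : diskAut c c = 0 := by simp [diskAut]

@[simp] theorem diskAut_neg_zero (c : ℂ) : diskAut (-c) 0 = c := by simp [diskAut]

variable {c w : ℂ}

theorem diskAut_denom_ne_zero (hc : ‖c‖ < 1) (hw : ‖w‖ < 1) : 1 - conj c * w ≠ 0 := by
  intro h
  have h1 : ‖conj c * w‖ = 1 := by rw [← sub_eq_zero.1 h, norm_one]
  rw [norm_mul, Complex.norm_conj] at h1
  nlinarith [norm_nonneg c, norm_nonneg w]

theorem one_sub_norm_diskAut_sq (hc : ‖c‖ < 1) (hw : ‖w‖ < 1) : 1 - ‖diskAut c w‖ ^ 2 =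
    (1 - ‖c‖ ^ 2) * (1 - ‖w‖ ^ 2) / ‖1 - conj c * w‖ ^ 2 := by
  have h := diskAut_denom_ne_zero hc hw
  have h0 : ‖1 - conj c * w‖ ^ 2 ≠ 0 := by simpa using h
  rw [diskAut, norm_div, div_pow, eq_div_iff h0, sub_mul, div_mul_cancel₀ _ h0]
  simp only [← Complex.normSq_eq_norm_sq, Complex.normSq_apply]
  simp
  ring

theorem norm_diskAut_lt_one (hc : ‖c‖ < 1) (hw : ‖w‖ < 1) : ‖diskAut c w‖ < 1 := by
  have h := diskAut_denom_ne_zero hc hw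
  have h1 := one_sub_norm_diskAut_sq hc hw
  have h2 : 0 < (1 - ‖c‖ ^ 2) * (1 - ‖w‖ ^ 2) / ‖1 - conj c * w‖ ^ 2 := by
    have : 0 < 1 - ‖c‖ ^ 2 := by nlinarith [norm_nonneg c]
    have : 0 < 1 - ‖w‖ ^ 2 := by nlinarith [norm_nonneg w]
    have : 0 < ‖1 - conj c * w‖ := norm_pos_iff.2 h
    positivity
  nlinarith [norm_nonneg (diskAut c w)]

theorem diskAut_neg_diskAut (hc : ‖c‖ < 1) (hw : ‖w‖ < 1) : diskAut (-c) (diskAut c w) = w := by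
  have h := diskAut_denom_ne_zero hc hw
  have h3 := diskAut_denom_ne_zero (c := -c) (by simpa using hc) (norm_diskAut_lt_one hc hw)
  have hX : diskAut c w * (1 - conj c * w) = w - c := div_mul_cancel₀ _ h
  rw [diskAut, div_eq_iff h3, map_neg]
  linear_combination hX

theorem hasDerivAt_diskAut (hc : ‖c‖ < 1) (hw : ‖w‖ < 1) :
    HasDerivAt (diskAut c) ((1 - ‖c‖ ^ 2 : ℝ) / (1 - conj c * w) ^ 2) w := by
  have h := diskAut_denom_ne_zero hc hw
  have h1 := ((hasDerivAt_id w).sub_const c).div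
    (((hasDerivAt_id w).const_mul (conj c)).const_sub 1) h
  convert! h1 using 1
  congr 1
  rw [Complex.ofReal_sub, Complex.ofReal_pow, ← Complex.conj_mul']
  simp
  ring

/-- `diskAut c` is an isometry of the hyperbolic metric. -/
theorem norm_deriv_diskAut_mul (hc : ‖c‖ < 1) (hw : ‖w‖ < 1) :
    ‖deriv (diskAut c) w‖ * (1 - ‖w‖ ^ 2) = 1 - ‖diskAut c w‖ ^ 2 := by
  have : 0 ≤ 1 - ‖c‖ ^ 2 := by nlinarith [norm_nonneg c]
  rw [(hasDerivAt_diskAut hc hw).deriv, one_sub_norm_diskAut_sq hc hw, norm_div, norm_pow,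
    Complex.norm_real, Real.norm_of_nonneg this]
  ring

/-- The **Schwarz–Pick lemma**, infinitesimal form. -/
theorem norm_deriv_mul_le_of_mapsTo_disk {T : ℂ → ℂ} (hT : DifferentiableOn ℂ T (ball 0 1))
    (hmaps : MapsTo T (ball 0 1) (ball 0 1)) (hw : ‖w‖ < 1) :
    ‖deriv T w‖ * (1 - ‖w‖ ^ 2) ≤ 1 - ‖T w‖ ^ 2 := by
  have hTw : ‖T w‖ < 1 := by simpa using hmaps (by simpa using hw)
  have hnw : ‖-w‖ < 1 := by simpa using hw
  have hTd : ∀ z : ℂ, ‖z‖ < 1 → DifferentiableAt ℂ T z := fun z hz =>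
    hT.differentiableAt (isOpen_ball.mem_nhds (by simpa using hz))
  set H : ℂ → ℂ := fun z => diskAut (T w) (T (diskAut (-w) z)) with hH
  have hH0 : H 0 = 0 := by simp [hH]
  have hdiff : ∀ z : ℂ, ‖z‖ < 1 → ‖H z‖ < 1 ∧ HasDerivAt H (deriv (diskAut (T w))
      (T (diskAut (-w) z)) * (deriv T (diskAut (-w) z) * deriv (diskAut (-w)) z)) z := by
    intro z hz
    have h1 := norm_diskAut_lt_one hnw hz
    have h2 : ‖T (diskAut (-w) z)‖ < 1 := by simpa using hmaps (by simpa using h1)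
    refine ⟨norm_diskAut_lt_one hTw h2, ?_⟩
    exact (hasDerivAt_diskAut hTw h2).differentiableAt.hasDerivAt.comp z
      ((hTd _ h1).hasDerivAt.comp z (hasDerivAt_diskAut hnw hz).differentiableAt.hasDerivAt)
  have hS : ‖deriv H 0‖ ≤ 1 := by
    refine Complex.norm_deriv_le_one_of_mapsTo_ball (R := 1)
      (fun z hz => (hdiff z (by simpa using hz)).2.differentiableAt.differentiableWithinAt)
      (fun z hz => ?_) one_pos
    rw [hH0, mem_closedBall_zero_iff]
    exact (hdiff z (by simpa using hz)).1.le
  have h1 := norm_deriv_diskAut_mul hTw hTw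
  have h2 := norm_deriv_diskAut_mul hnw (w := 0) (by simp)
  rw [(hdiff 0 (by simp)).2.deriv, diskAut_neg_zero, norm_mul, norm_mul] at hS
  simp at h1 h2
  rw [h2] at hS
  have h3 : 0 < 1 - ‖T w‖ ^ 2 := by nlinarith [norm_nonneg (T w)]
  calc _ = (‖deriv (diskAut (T w)) (T w)‖ * (‖deriv T w‖ * (1 - ‖w‖ ^ 2))) * (1 - ‖T w‖ ^ 2) := by
        linear_combination (-‖deriv T w‖ * (1 - ‖w‖ ^ 2)) * h1
    _ ≤ 1 * (1 - ‖T w‖ ^ 2) := mul_le_mul_of_nonneg_right hS h3.le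
    _ = _ := one_mul _

/-- Conformal self-maps of the disk are isometries of the hyperbolic metric. -/
theorem IsConformalSelfMapOfDisk.norm_deriv_mul {T : ℂ → ℂ} (hT : IsConformalSelfMapOfDisk T)
    (hw : ‖w‖ < 1) : ‖deriv T w‖ * (1 - ‖w‖ ^ 2) = 1 - ‖T w‖ ^ 2 := by
  obtain ⟨hTa, hTm, hTi, hTs⟩ := hT
  have hwb : w ∈ ball (0 : ℂ) 1 := by simpa using hw
  have h1 := norm_deriv_mul_le_of_mapsTo_disk hTa.differentiableOn hTm hw
  set S := Function.invFunOn T (ball 0 1)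
  have hTw : ‖T w‖ < 1 := by simpa using hTm hwb
  have hSd : DifferentiableOn ℂ S (ball 0 1) := by
    intro y hy
    obtain ⟨z, hz, rfl⟩ := hTs hy
    exact (hasDerivAt_invFunOn isOpen_ball hTa hTi hz).2.differentiableAt.differentiableWithinAt
  have hSm : MapsTo S (ball 0 1) (ball 0 1) := fun y hy => Function.invFunOn_mem (hTs hy)
  have h2 := norm_deriv_mul_le_of_mapsTo_disk hSd hSm hTw
  obtain ⟨hd, hS⟩ := hasDerivAt_invFunOn isOpen_ball hTa hTi hwb
  have hSw : S (T w) = w := hTi.leftInvOn_invFunOn hwb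
  rw [hS.deriv, hSw, norm_inv, inv_mul_le_iff₀ (norm_pos_iff.2 hd)] at h2
  exact le_antisymm h1 h2

end Disk

/-! ### Rigidity -/

section Rigidity

open Filter Asymptotics

/-- Two germs with the same value `0` and the same nonzero derivative at `a` that pull the
hyperbolic metric back to the same metric agree. Otherwise `f' - g'` has a leading term
`e * (z - a) ^ m` with `m ≥ 1`, whereas equality of the metrics forces
`Re (conj (g' a) * e * (z - a) ^ m)` to vanish to order `m + 1`. -/
theorem eventuallyEq_of_pullback_eq {f g : ℂ → ℂ} {a : ℂ} (hf : AnalyticAt ℂ f a)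
    (hg : AnalyticAt ℂ g a) (hfa : f a = 0) (hga : g a = 0) (hd : deriv f a = deriv g a)
    (hd0 : deriv g a ≠ 0)
    (h : ∀ᶠ z in 𝓝 a, ‖deriv f z‖ * (1 - ‖g z‖ ^ 2) = ‖deriv g z‖ * (1 - ‖f z‖ ^ 2)) :
    f =ᶠ[𝓝 a] g := by
  set d : ℂ → ℂ := fun z => deriv f z - deriv g z with hd_def
  have hda : AnalyticAt ℂ d a := hf.deriv.sub hg.deriv
  have hDd : ∀ᶠ z in 𝓝 a, HasDerivAt (fun z => f z - g z) (d z) z := by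
    filter_upwards [hf.eventually_analyticAt, hg.eventually_analyticAt] with z h1 h2
    exact h1.differentiableAt.hasDerivAt.sub h2.differentiableAt.hasDerivAt
  -- a bound on `f' - g'` near `a` integrates to a bound on `f - g`
  have hmv : ∀ (C : ℝ) (n : ℕ), 0 ≤ C → (∀ᶠ z in 𝓝 a, ‖d z‖ ≤ C * ‖z - a‖ ^ n) →
      ∀ᶠ z in 𝓝 a, ‖f z - g z‖ ≤ C * ‖z - a‖ ^ (n + 1) := by
    intro C n hC hb
    obtain ⟨r, hr, hball⟩ := Metric.eventually_nhds_iff_ball.1 (hb.and hDd)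
    filter_upwards [ball_mem_nhds a hr] with z hz
    have hsub : closedBall a ‖z - a‖ ⊆ ball a r :=
      closedBall_subset_ball (by rwa [← dist_eq_norm])
    have := (convex_closedBall a ‖z - a‖).norm_image_sub_le_of_norm_hasDerivWithin_le
      (f := fun z => f z - g z) (f' := d) (C := C * ‖z - a‖ ^ n)
      (fun x hx => (hball x (hsub hx)).2.hasDerivWithinAt)
      (fun x hx => (hball x (hsub hx)).1.trans (by
        rw [mem_closedBall, dist_eq_norm] at hx
        gcongr))
      (mem_closedBall_self (norm_nonneg _)) (by rw [mem_closedBall, dist_eq_norm])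
    simpa [hfa, hga, pow_succ, mul_assoc] using this
  by_cases hz : ∀ᶠ z in 𝓝 a, d z = 0
  · have := hmv 0 0 le_rfl (hz.mono fun z hz => by simp [hz])
    exact this.mono fun z hz => by simpa [sub_eq_zero] using hz
  exfalso
  obtain ⟨m, e, he, hea, hde⟩ := hda.exists_eventuallyEq_pow_smul_nonzero_iff.2 hz
  have hm : m ≠ 0 := by
    rintro rfl
    have := hde.self_of_nhds
    simp [hd_def, hd] at this
    exact hea this.symm
  set φ : ℂ → ℝ := fun z => ‖z - a‖ ^ (m + 1) with hφ
  have hcont : ∀ {F : ℂ → ℝ}, ContinuousAt F a → F =O[𝓝 a] fun _ => (1 : ℝ) := fun hF =>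
    hF.tendsto.isBigO_one ℝ
  have hdm : d =O[𝓝 a] fun z => ‖z - a‖ ^ m := by
    have hde' : d =ᶠ[𝓝 a] fun z => (z - a) ^ m * e z := hde
    have h1 : (fun z => (z - a) ^ m) =O[𝓝 a] fun z => ‖z - a‖ ^ m :=
      IsBigO.of_norm_left (by simpa using isBigO_refl _ _)
    simpa using hde'.trans_isBigO (h1.mul (he.continuousAt.tendsto.isBigO_one ℝ))
  have hfg : (fun z => f z - g z) =O[𝓝 a] φ := by
    obtain ⟨C, hC, hCb⟩ := hdm.exists_pos
    refine IsBigO.of_bound C ((hmv C m hC.le ?_).mono fun z hz => ?_)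
    · exact hCb.bound.mono fun z hz => by simpa using hz
    · simpa [hφ] using hz
  have cf := hf.continuousAt.norm
  have cg := hg.continuousAt.norm
  have cf' := hf.deriv.continuousAt.norm
  have cg' := hg.deriv.continuousAt.norm
  have hnorm : (fun z => ‖g z‖ - ‖f z‖) =O[𝓝 a] φ := by
    refine (IsBigO.of_bound 1 (Eventually.of_forall fun z => ?_)).trans hfg
    rw [one_mul, Real.norm_eq_abs, norm_sub_rev]
    exact abs_norm_sub_norm_le _ _
  have hderiv : (fun z => ‖deriv f z‖ ^ 2 - ‖deriv g z‖ ^ 2) =O[𝓝 a] φ := by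
    have h1 : (fun z => (‖g z‖ - ‖f z‖) * ((‖g z‖ + ‖f z‖) * ‖deriv g z‖ * (1 - ‖g z‖ ^ 2)⁻¹ *
        (‖deriv f z‖ + ‖deriv g z‖))) =O[𝓝 a] fun z => φ z * 1 := by
      refine hnorm.mul (hcont ?_)
      refine (((cg.add cf).mul cg').mul ?_).mul (cf'.add cg')
      exact (continuousAt_const.sub (cg.pow 2)).inv₀ (by simp [hga])
    simp only [mul_one] at h1
    refine EventuallyEq.trans_isBigO ?_ h1
    have hlt : ∀ᶠ z in 𝓝 a, ‖g z‖ < 1 := cg.eventually_lt continuousAt_const (by simp [hga])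
    filter_upwards [h, hlt] with z hz hzl
    have : 1 - ‖g z‖ ^ 2 ≠ 0 := by nlinarith [norm_nonneg (g z)]
    field_simp
    linear_combination (‖deriv f z‖ + ‖deriv g z‖) * hz
  have hd2 : (fun z => ‖d z‖ ^ 2) =O[𝓝 a] φ := by
    have h1 := (hdm.norm_left.pow 2)
    refine h1.trans (IsBigO.of_bound 1 ?_)
    filter_upwards [ball_mem_nhds a one_pos] with z hz
    rw [mem_ball, dist_eq_norm] at hz
    simp only [hφ, norm_pow, norm_norm, one_mul, ← pow_mul]
    exact pow_le_pow_of_le_one (norm_nonneg _) hz.le (by lia)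
  have hre : (fun z => (conj (deriv g z) * ((z - a) ^ m * e z)).re) =O[𝓝 a] φ := by
    have h1 := (hderiv.sub hd2).const_mul_left (1 / 2)
    refine EventuallyEq.trans_isBigO ?_ h1
    filter_upwards [hde] with z hz
    rw [← smul_eq_mul ((z - a) ^ m), ← hz]
    simp only [← Complex.normSq_eq_norm_sq, Complex.normSq_apply, hd_def]
    simp
    ring
  obtain ⟨C, hC⟩ := hre.bound
  -- a direction in which the leading term is real and positive
  set c := conj (deriv g a) * e a with hc
  have hc0 : c ≠ 0 := mul_ne_zero (by simpa using hd0) hea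
  obtain ⟨ζ, hζ⟩ := IsAlgClosed.exists_pow_nat_eq (conj c) (Nat.pos_of_ne_zero hm)
  have hline : Tendsto (fun t : ℝ => a + t * ζ) (𝓝[>] 0) (𝓝 a) := by
    have : Continuous fun t : ℝ => a + t * ζ := by fun_prop
    simpa using (this.tendsto 0).mono_left nhdsWithin_le_nhds
  have hlim : Tendsto (fun t : ℝ => |(conj (deriv g (a + t * ζ)) * e (a + t * ζ) * ζ ^ m).re|)
      (𝓝[>] 0) (𝓝 |(c * ζ ^ m).re|) := by
    have h1 : ContinuousAt (fun z => |(conj (deriv g z) * e z * ζ ^ m).re|) a :=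
      (Complex.continuous_re.continuousAt.comp (((Complex.continuous_conj.continuousAt.comp
        hg.deriv.continuousAt).mul he.continuousAt).mul continuousAt_const)).abs
    exact h1.tendsto.comp hline
  have hlim0 : Tendsto (fun t : ℝ => C * ‖ζ‖ ^ (m + 1) * t) (𝓝[>] 0) (𝓝 0) := by
    have : Continuous fun t : ℝ => C * ‖ζ‖ ^ (m + 1) * t := by fun_prop
    simpa using (this.tendsto 0).mono_left nhdsWithin_le_nhds
  have hle : |(c * ζ ^ m).re| ≤ 0 := by
    refine le_of_tendsto_of_tendsto hlim hlim0 ?_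
    filter_upwards [hline.eventually hC, self_mem_nhdsWithin] with t ht (ht0 : 0 < t)
    have h1 : (conj (deriv g (a + t * ζ)) * ((a + t * ζ - a) ^ m * e (a + t * ζ))).re =
        t ^ m * (conj (deriv g (a + t * ζ)) * e (a + t * ζ) * ζ ^ m).re := by
      rw [← Complex.re_ofReal_mul]
      congr 1
      push_cast
      ring
    rw [h1] at ht
    simp only [hφ, add_sub_cancel_left, norm_mul, norm_pow, Real.norm_eq_abs, Complex.norm_real,
      abs_of_pos ht0, abs_norm] at ht
    refine le_of_mul_le_mul_left (ht.trans_eq ?_) (pow_pos ht0 m)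
    ring
  rw [hζ, Complex.mul_conj, Complex.ofReal_re] at hle
  exact hc0 (Complex.normSq_eq_zero.1 (le_antisymm ((le_abs_self _).trans hle)
    (Complex.normSq_nonneg _)))

/-- The pull-back of the hyperbolic metric does not change under postcomposition with a map that is
isometric at the point in question. -/
theorem pullback_comp {T f : ℂ → ℂ} {z : ℂ} (hf : DifferentiableAt ℂ f z) (hfz : ‖f z‖ < 1)
    (hTz : ‖T (f z)‖ < 1) (hT : DifferentiableAt ℂ T (f z))
    (hiso : ‖deriv T (f z)‖ * (1 - ‖f z‖ ^ 2) = 1 - ‖T (f z)‖ ^ 2) :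
    2 * ‖deriv (fun w => T (f w)) z‖ / (1 - ‖T (f z)‖ ^ 2) = 2 * ‖deriv f z‖ / (1 - ‖f z‖ ^ 2) := by
  have h1 : 1 - ‖f z‖ ^ 2 ≠ 0 := by nlinarith [norm_nonneg (f z)]
  have h2 : 1 - ‖T (f z)‖ ^ 2 ≠ 0 := by nlinarith [norm_nonneg (T (f z))]
  have h3 : deriv (fun w => T (f w)) z = deriv T (f z) * deriv f z := deriv_comp z hT hf
  rw [h3, norm_mul, div_eq_div_iff h2 h1, ← hiso]
  ring

theorem isConformalSelfMapOfDisk_diskAut_comp {a b ρ : ℂ} (ha : ‖a‖ < 1) (hb : ‖b‖ < 1)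
    (hρ : ‖ρ‖ = 1) : IsConformalSelfMapOfDisk fun w => diskAut (-b) (ρ * diskAut a w) := by
  have hmem : ∀ w : ℂ, w ∈ ball (0 : ℂ) 1 ↔ ‖w‖ < 1 := fun w => mem_ball_zero_iff
  have hρ0 : ρ ≠ 0 := norm_ne_zero_iff.1 (by rw [hρ]; exact one_ne_zero)
  have hnb : ‖-b‖ < 1 := by rwa [norm_neg]
  have hna : ‖-a‖ < 1 := by rwa [norm_neg]
  have hmul : ∀ w, ‖ρ * w‖ = ‖w‖ := fun w => by rw [norm_mul, hρ, one_mul]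
  have hmul' : ∀ w, ‖ρ⁻¹ * w‖ = ‖w‖ := fun w => by rw [norm_mul, norm_inv, hρ, inv_one, one_mul]
  have hinv : ∀ {c w : ℂ}, ‖c‖ < 1 → ‖w‖ < 1 → diskAut c (diskAut (-c) w) = w := by
    intro c w hc hw
    simpa using diskAut_neg_diskAut (c := -c) (by rwa [norm_neg]) hw
  refine ⟨DifferentiableOn.analyticOnNhd (fun w hw => ?_) isOpen_ball,
    InvOn.bijOn (f' := fun w => diskAut (-a) (ρ⁻¹ * diskAut b w)) ⟨?_, ?_⟩ ?_ ?_⟩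
  · rw [hmem] at hw
    have h1 := norm_diskAut_lt_one ha hw
    rw [← hmul] at h1
    exact ((hasDerivAt_diskAut hnb h1).comp w
      ((hasDerivAt_diskAut ha hw).const_mul ρ)).differentiableAt.differentiableWithinAt
  · intro w hw
    rw [hmem] at hw
    have h1 := norm_diskAut_lt_one ha hw
    simp only
    rw [hinv hb (by rwa [hmul]), inv_mul_cancel_left₀ hρ0, diskAut_neg_diskAut ha hw]
  · intro w hw
    rw [hmem] at hw
    have h1 := norm_diskAut_lt_one hb hw
    simp only
    rw [hinv ha (by rwa [hmul']), mul_inv_cancel_left₀ hρ0, diskAut_neg_diskAut hb hw]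
  · intro w hw
    rw [hmem] at hw ⊢
    exact norm_diskAut_lt_one hnb (by rw [hmul]; exact norm_diskAut_lt_one ha hw)
  · intro w hw
    rw [hmem] at hw ⊢
    exact norm_diskAut_lt_one hna (by rw [hmul']; exact norm_diskAut_lt_one hb hw)

/-- **Rigidity.** Two holomorphic maps to the disk that pull the hyperbolic metric back to the same
nonvanishing metric on a domain differ by an automorphism of the disk. -/
theorem exists_conformalSelfMap_of_pullback_eq {f g : ℂ → ℂ} {G : Set ℂ} (hG : IsOpen G)
    (hGc : IsPreconnected G) {z₀ : ℂ} (hz₀ : z₀ ∈ G) (hf : AnalyticOnNhd ℂ f G)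
    (hg : AnalyticOnNhd ℂ g G) (hfm : MapsTo f G (ball 0 1)) (hgm : MapsTo g G (ball 0 1))
    (hpos : 2 * ‖deriv f z₀‖ / (1 - ‖f z₀‖ ^ 2) ≠ 0)
    (h : ∀ z ∈ G, 2 * ‖deriv f z‖ / (1 - ‖f z‖ ^ 2) = 2 * ‖deriv g z‖ / (1 - ‖g z‖ ^ 2)) :
    ∃ T : ℂ → ℂ, IsConformalSelfMapOfDisk T ∧ ∀ z ∈ G, g z = T (f z) := by
  have hfn : ∀ z ∈ G, ‖f z‖ < 1 := fun z hz => mem_ball_zero_iff.1 (hfm hz)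
  have hgn : ∀ z ∈ G, ‖g z‖ < 1 := fun z hz => mem_ball_zero_iff.1 (hgm hz)
  have ha := hfn z₀ hz₀
  have hb := hgn z₀ hz₀
  -- move the images of `z₀` to the centre of the disk
  have hnorm : ∀ F : ℂ → ℂ, AnalyticOnNhd ℂ F G → (∀ z ∈ G, ‖F z‖ < 1) →
      AnalyticOnNhd ℂ (fun w => diskAut (F z₀) (F w)) G ∧
      (∀ z ∈ G, ‖diskAut (F z₀) (F z)‖ < 1) ∧
      ∀ z ∈ G, 2 * ‖deriv (fun w => diskAut (F z₀) (F w)) z‖ / (1 - ‖diskAut (F z₀) (F z)‖ ^ 2) =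
        2 * ‖deriv F z‖ / (1 - ‖F z‖ ^ 2) := by
    intro F hF hFn
    have h0 := hFn z₀ hz₀
    refine ⟨DifferentiableOn.analyticOnNhd (fun z hz => ?_) hG,
      fun z hz => norm_diskAut_lt_one h0 (hFn z hz), fun z hz => ?_⟩
    · exact ((hasDerivAt_diskAut h0 (hFn z hz)).differentiableAt.comp z
        (hF z hz).differentiableAt).differentiableWithinAt
    · exact pullback_comp (hF z hz).differentiableAt (hFn z hz)
        (norm_diskAut_lt_one h0 (hFn z hz)) (hasDerivAt_diskAut h0 (hFn z hz)).differentiableAt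
        (norm_deriv_diskAut_mul h0 (hFn z hz))
  obtain ⟨hf1, hf1n, hf1p⟩ := hnorm f hf hfn
  obtain ⟨hg1, hg1n, hg1p⟩ := hnorm g hg hgn
  set f₁ : ℂ → ℂ := fun w => diskAut (f z₀) (f w) with hf₁
  set g₁ : ℂ → ℂ := fun w => diskAut (g z₀) (g w) with hg₁
  have hf0 : f₁ z₀ = 0 := diskAut_self _
  have hg0 : g₁ z₀ = 0 := diskAut_self _
  have heq : ∀ z ∈ G, ‖deriv f₁ z‖ * (1 - ‖g₁ z‖ ^ 2) = ‖deriv g₁ z‖ * (1 - ‖f₁ z‖ ^ 2) := by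
    intro z hz
    have h1 := (hf1p z hz).trans ((h z hz).trans (hg1p z hz).symm)
    have h2 : 1 - ‖f₁ z‖ ^ 2 ≠ 0 := by nlinarith [norm_nonneg (f₁ z), hf1n z hz]
    have h3 : 1 - ‖g₁ z‖ ^ 2 ≠ 0 := by nlinarith [norm_nonneg (g₁ z), hg1n z hz]
    rw [div_eq_div_iff h2 h3] at h1
    linarith
  have hder : ‖deriv f₁ z₀‖ = ‖deriv g₁ z₀‖ := by simpa [hf0, hg0] using heq z₀ hz₀
  have hf' : deriv f₁ z₀ ≠ 0 := by
    intro h0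
    have := hf1p z₀ hz₀
    rw [h0, norm_zero, mul_zero, zero_div] at this
    exact hpos this.symm
  -- a rotation matches the derivatives
  set ρ := deriv g₁ z₀ / deriv f₁ z₀ with hρ_def
  have hρ : ‖ρ‖ = 1 := by
    rw [hρ_def, norm_div, hder, div_self]
    rw [← hder]
    exact norm_ne_zero_iff.2 hf'
  have hρd : ∀ z, deriv (fun w => ρ * f₁ w) z = ρ * deriv f₁ z := fun z => deriv_const_mul_field ρ
  have hρf : AnalyticOnNhd ℂ (fun w => ρ * f₁ w) G := fun z hz => analyticAt_const.mul (hf1 z hz)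
  have hρ' : ρ * deriv f₁ z₀ = deriv g₁ z₀ := div_mul_cancel₀ _ hf'
  have hloc : (fun w => ρ * f₁ w) =ᶠ[𝓝 z₀] g₁ := by
    refine eventuallyEq_of_pullback_eq (hρf z₀ hz₀) (hg1 z₀ hz₀) (by simp [hf0]) hg0
      (by rw [hρd, hρ']) ?_ ?_
    · exact norm_ne_zero_iff.1 (hder ▸ norm_ne_zero_iff.2 hf')
    · filter_upwards [hG.mem_nhds hz₀] with z hz
      rw [hρd, norm_mul, norm_mul, hρ, one_mul, one_mul]
      exact heq z hz
  have hglob := hρf.eqOn_of_preconnected_of_eventuallyEq hg1 hGc hz₀ hloc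
  refine ⟨_, isConformalSelfMapOfDisk_diskAut_comp ha hb hρ, fun z hz => ?_⟩
  have h1 : ρ * diskAut (f z₀) (f z) = diskAut (g z₀) (g z) := hglob hz
  rw [h1, diskAut_neg_diskAut hb (hgn z hz)]

end Rigidity

theorem mainTheorem3 (G : Set ℂ) (hGo : IsOpen G) (hGs : IsSimplyConnected G)
    (lam : ℂ → ℝ) (hlam : IsRegularConformalMetricOn lam G)
    (hcurv : ∀ z ∈ G, gaussCurvature lam z = -1) :
    (∃ f : ℂ → ℂ, IsLocallyUnivalentToDisk f G ∧
      ∀ z ∈ G, lam z = 2 * ‖deriv f z‖ / (1 - ‖f z‖ ^ 2)) ∧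
    ∀ f : ℂ → ℂ, IsLocallyUnivalentToDisk f G →
      (∀ z ∈ G, lam z = 2 * ‖deriv f z‖ / (1 - ‖f z‖ ^ 2)) →
      ∀ g : ℂ → ℂ, IsLocallyUnivalentToDisk g G →
        ((∀ z ∈ G, lam z = 2 * ‖deriv g z‖ / (1 - ‖g z‖ ^ 2)) ↔
          ∃ T : ℂ → ℂ, IsConformalSelfMapOfDisk T ∧ ∀ z ∈ G, g z = T (f z)) := by
  obtain ⟨⟨-, hpos⟩, hC2⟩ := hlam
  have hset : {z ∈ G | 0 < lam z} = G := sep_eq_self_iff_mem_true.2 hpos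
  rw [hset] at hC2
  refine ⟨?_, fun f hf hfl g hg => ⟨fun hgl => ?_, ?_⟩⟩
  · set u : ℂ → ℝ := fun w => Real.log (lam w) with hu
    have hexp : ∀ z ∈ G, Real.exp (u z) = lam z := fun z hz => Real.exp_log (hpos z hz)
    have hΔ : ∀ z ∈ G, Laplacian.laplacian u z = Real.exp (u z) ^ 2 := by
      intro z hz
      have h := hcurv z hz
      have h0 : lam z ^ 2 ≠ 0 := pow_ne_zero 2 (hpos z hz).ne'
      rw [gaussCurvature, div_eq_iff h0] at h
      rw [hexp z hz]
      linarith
    obtain ⟨f, hfd, hf⟩ := exists_developing_map hGo hGs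
      (hC2.log fun z hz => (hpos z hz).ne') hΔ
    have hfa := hfd.analyticOnNhd hGo
    refine ⟨f, ⟨hfa, fun z hz => mem_ball_zero_iff.2 (hf z hz).1, fun z hz => ?_⟩,
      fun z hz => by rw [← hexp z hz, (hf z hz).2]⟩
    refine exists_isOpen_injOn_of_deriv_ne_zero hGo hz (hfa z hz) fun h0 => ?_
    have h1 := (hf z hz).2
    rw [h0, norm_zero, mul_zero, zero_div] at h1
    exact (Real.exp_pos _).ne' h1
  · obtain ⟨z₀, hz₀⟩ := hGs.nonempty
    exact exists_conformalSelfMap_of_pullback_eq hGo hGs.isPathConnected.isConnected.isPreconnected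
      hz₀ hf.1 hg.1 hf.2.1 hg.2.1 (hfl z₀ hz₀ ▸ (hpos z₀ hz₀).ne')
      fun z hz => (hfl z hz).symm.trans (hgl z hz)
  · rintro ⟨T, hT, hgT⟩ z hz
    have hfz : ‖f z‖ < 1 := mem_ball_zero_iff.1 (hf.2.1 hz)
    have hfb : f z ∈ ball (0 : ℂ) 1 := hf.2.1 hz
    have hTz : ‖T (f z)‖ < 1 := mem_ball_zero_iff.1 (hT.2.mapsTo hfb)
    have hev : g =ᶠ[𝓝 z] fun w => T (f w) := by
      filter_upwards [hGo.mem_nhds hz] with w hw using hgT w hw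
    rw [hfl z hz, hev.deriv_eq, hgT z hz]
    exact (pullback_comp (hf.1 z hz).differentiableAt hfz hTz (hT.1 _ hfb).differentiableAt
      (hT.norm_deriv_mul hfz)).symm
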